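/- \textbf{Theorem (Privacy of DOME with adaptive clipping).} \emph{Data.} There are $M$ clients; client $i$ has $N$ record positions $n=1,\dots,N$, and in position $n$ it holds at most one record $x_i^n\in X$. Two datasets are adjacent if they are equal or if one of them is the other one with a single record (of one client) added. A loss $\mathcal L(\theta,x)$, $\theta\in\mathbb R^d$, $x \in X$, is given (where $\mathcal L(\cdot,x)$ is not differentiable at $\theta$, its gradient is read as $0$). \emph{Parameters.} Let $k\le d$, $B\ge 1$, $E\ge 0$ be integers, $C>0$, $\sigma>0$, and let $\eta,\beta_1,\beta_2,\gamma',q$ be real numbers (for instance $\beta_1,\beta_2\in[0,1)$, $\gamma'>0$, $q\in[0,1]$; outside these ranges, and where a formula below divides by zero, use the conventions $x/0=0$, and $\sqrt{x}=0$ for $x<0$). Put $a^2=\frac{NE}{B}\sigma^2C^2$. \emph{QR decomposition.} The decomposition $Y=QR$ is computed by the Gram--Schmidt procedure, with $R=Q^\top Y$. If a column of $Y$ depends linearly on the preceding columns of $Q$, the first standard basis vector that does not so depend is orthonormalized in its place, so that $Q^\top Q=I$ always. \emph{Algorithm DOME.} Each of the $E$ epochs consists of finitely many rounds. In every round a set $\mathcal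 U$ of exactly $B$ clients is selected, and each selected client draws one of its positions not yet drawn in this epoch (or none, if all have been drawn); in each epoch every position of every client is drawn exactly once. These choices, called the schedule, follow an arbitrary probability law that does not depend on the data. The parameter $\theta_0$ is drawn from an arbitrary probability law, $S$ is initially the $Q$-factor of a $d\times k$ matrix with i.i.d. $\mathcal N(0,1)$ entries, and $\tilde m_0=\hat m_0=\tilde v_0=0$, $U_0=0$, $\Lambda_0=0$. Rounds are numbered $t=1,2,\dots$ through all epochs. In round $t$, with $S$ the current sketch: \begin{enumerate} \item Each $i\in\mathcal U$ with a record $x$ in the position it has drawn computes $s_i=S^\top(\nabla_\theta\mathcal L(\theta_{t-1},x)-\hat m_{t-1})$ and clips it to $s_i^{clip}=s_i\min(1,C/\|s_i\|_2)$; if there is no record in the position drawn or no position was drawn, $s_i^{clip}=0$. It adds independent noise $z_i\sim\mathcal N(0,a^2)^k$. \item Secure Aggregation reveals to the server only $g_t^{prec}=\frac1B\sum_{i\in\mathcal U}(s_i^{clip}+z_i)$. \item The server computes $\hat g_t=S g_t^{prec}+\hat m_{t-1}$ and, coordinatewise, \[\tilde m_t=\beta_1\tilde m_{t-1}+(1-\beta_1)\hat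 g_t,\qquad \hat m_t=\frac{\tilde m_t}{1-\beta_1^t},\] \[\tilde v_t=\beta_2\tilde v_{t-1}+(1-\beta_2)\bigl(\hat g_t^2-a^2\,\mathrm{Diag}(SS^\top)\bigr),\qquad \hat v_t=\frac{\tilde v_t}{1-\beta_2^t},\] \[\theta_t=\theta_{t-1}-\eta\,\frac{\hat m_t}{\sqrt{\max(\hat v_t,\gamma')}}.\] \item The server sets $Y=\hat g_t\hat g_t^\top S$ if $t=1$ and $Y=U_{t-1}\Lambda_{t-1}+\hat g_t\hat g_t^\top U_{t-1}$ if $t>1$, takes $(U_t,R)=\mathrm{QR}(Y)$, and lets $\Lambda_t$ be the diagonal matrix of the Euclidean norms of the columns of $R$. Let $r\le k$ be the least number with $\sum_{i\le r}(\Lambda_t)_{ii}^2\ge q\sum_{i\le k}(\Lambda_t)_{ii}^2$ (and $r=0$ if there is none), and let $U'$ consist of the first $r$ columns of $U_t$. With $\Omega$ a $d\times(k-r)$ matrix of fresh independent $\mathcal N(0,1)$ entries and $Q$ the $Q$-factor of $(I-U'U'^\top)\Omega$, the new sketch is $S=[\,U'\,|\,Q\,]$. \end{enumerate} The schedule, $\theta_0$,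 the initial Gaussian matrix, all noises $z_i$ and all matrices $\Omega$ are independent. The output of the algorithm is the schedule together with $g_t^{prec},\theta_t,\tilde m_t,\hat m_t,\tilde v_t,\hat v_t,U_t,\Lambda_t$ and the sketch $S$, for the initial state and after every round. \emph{Claim.} Let $\varepsilon>0$, $0<\delta<1$ and \[\sigma=\max\Bigl\{\frac1{\sqrt\varepsilon},\ \frac{2\sqrt2}{\varepsilon}\sqrt{\log(1/\delta)}\Bigr\}.\] Then algorithm DOME is $(\varepsilon,\delta)$-differentially private: its output $\mathcal M(D)$ is a well-defined random element, and for all adjacent datasets $D,D'$ and every measurable set $A$ of outputs, \[\Pr[\mathcal M(D)\in A]\le e^{\varepsilon}\,\Pr[\mathcal M(D')\in A]+\delta .\] -/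

import Mathlib

open MeasureTheory ProbabilityTheory

noncomputable section

namespace DOME

/-! ### Differential privacy -/

/-- A randomized mechanism `Mech`, given by the law `Mech D` of its output on the dataset `D`,
is `(ε, δ)`-differentially private with respect to the adjacency relation `adj`. -/
def IsDifferentiallyPrivate {𝒟 Out : Type*} [MeasurableSpace Out] (adj : 𝒟 → 𝒟 → Prop)
    (ε δ : ℝ) (Mech : 𝒟 → Measure Out) : Prop :=
  (∀ D, IsProbabilityMeasure (Mech D)) ∧
    ∀ D D', adj D D' → ∀ A : Set Out, MeasurableSet A →
      Mech D A ≤ ENNReal.ofReal (Real.exp ε) * Mech D' A + ENNReal.ofReal δ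

/-- A federated dataset: client `i : Fin M` has `N` record positions, and `D i n` is the record
`x_iⁿ`, or `none` if there is no record in that position. -/
abbrev Dataset (M N : ℕ) (X : Type*) := Fin M → Fin N → Option X

/-- Two datasets differ in at most one element: they are equal, or one of them is the other with
a single record (of a single client) added. -/
def Adjacent {M N : ℕ} {X : Type*} (D D' : Dataset M N X) : Prop :=
  D = D' ∨ ∃ (i : Fin M) (n : Fin N), (D i n = none ∨ D' i n = none) ∧
    ∀ j m, (j, m) ≠ (i, n) → D j m = D' j m

/-! ### Linear algebra -/

/-- Column vectors of length `d` with the Euclidean norm. A `d × p` matrix is represented by its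
family of columns `Fin p → Vec d`. -/
abbrev Vec (d : ℕ) := EuclideanSpace ℝ (Fin d)

/-- `v` minus its components along the vectors `q 0, …, q (j - 1)`. -/
def residualVec {d j : ℕ} (q : Fin j → Vec d) (v : Vec d) : Vec d :=
  v - ∑ i, inner ℝ (q i) v • q i

/-- `v / ‖v‖`. -/
def unitVec {d : ℕ} (v : Vec d) : Vec d := ‖v‖⁻¹ • v

open Classical in
/-- One Gram–Schmidt step: the normalized residual of the new column `y` against the previous
orthonormal columns `q`. If `y` depends linearly on these columns, the first standard basis vector
with a nonzero residual is used in place of `y`. -/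
def nextColumn {d j : ℕ} (q : Fin j → Vec d) (y : Vec d) : Vec d :=
  if residualVec q y ≠ 0 then unitVec (residualVec q y)
  else
    match (List.finRange d).find? (fun c => residualVec q (EuclideanSpace.single c 1) ≠ 0) with
    | some c => unitVec (residualVec q (EuclideanSpace.single c 1))
    | none => 0

/-- The factor `Q` of the QR decomposition `Y = Q R`, by the Gram–Schmidt procedure. -/
def qrQ {d p : ℕ} (Y : Fin p → Vec d) (j : Fin p) : Vec d :=
  nextColumn (fun i : Fin j.val => qrQ Y ⟨i.val, i.isLt.trans j.isLt⟩) (Y j)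
termination_by j.val
decreasing_by exact i.isLt

/-- The factor `R = Qᵀ Y` of the QR decomposition `Y = Q R`: the entry in row `i`, column `j`. -/
def qrR {d p : ℕ} (Y : Fin p → Vec d) (i j : Fin p) : ℝ :=
  inner ℝ (qrQ Y i) (Y j)

/-- `Sᵀ g`. -/
def sketch {d k : ℕ} (S : Fin k → Vec d) (g : Vec d) : Vec k :=
  WithLp.toLp 2 fun j => inner ℝ (S j) g

/-- `S s`. -/
def unsketch {d k : ℕ} (S : Fin k → Vec d) (s : Vec k) : Vec d :=
  ∑ j, s j • S j

/-- `NormClipping(s, C) = s · min (1, C / ‖s‖₂)`. -/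
def normClip {k : ℕ} (C : ℝ) (s : Vec k) : Vec k := min 1 (C / ‖s‖) • s

/-- The law `𝒩(0, v)^d` of a vector of `d` independent centred Gaussians of variance `v`. -/
def gaussianVec (d : ℕ) (v : ℝ) : Measure (Vec d) :=
  (Measure.pi fun _ : Fin d => gaussianReal 0 v.toNNReal).map (WithLp.toLp 2)

/-! ### Client selection -/

/-- The choices made in one communication round: a set of exactly `B` clients, and for each selected
client the position of the record it draws (`none` if it has no position left). -/
structure Round (M N B : ℕ) where
  clients : Finset (Fin M)
  card_clients : clients.card = B
  draw : Fin M → Option (Fin N)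
  draw_eq_none : ∀ i, i ∉ clients → draw i = none

/-- The choices made in a run of `E` epochs. In each epoch, which consists of finitely many rounds,
every record position of every client is drawn exactly once. -/
structure Schedule (M N B E : ℕ) where
  epoch : Fin E → List (Round M N B)
  full_pass : ∀ e i n, (epoch e).countP (fun r => decide (r.draw i = some n)) = 1

/-- The rounds of all epochs, in the order in which they are run. -/
def Schedule.rounds {M N B E : ℕ} (s : Schedule M N B E) : List (Round M N B) :=
  (List.ofFn s.epoch).flatten

instance (M N B E : ℕ) : MeasurableSpace (Schedule M N B E) := ⊤

/-! ### The algorithm -/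

/-- The hyperparameters: learning rate `η`, Adam parameters `β₁`, `β₂`, `γ'`, energy ratio `q` of the
sketch update, and clipping threshold `C`. -/
structure Hyper where
  η : ℝ
  β₁ : ℝ
  β₂ : ℝ
  γ' : ℝ
  q : ℝ
  C : ℝ

/-- The values the server holds after a round. -/
structure State (d k : ℕ) where
  /-- `g^prec`, the last output of Secure Aggregation, divided by `B` -/
  agg : Vec k
  /-- the model parameters `θ` -/
  θ : Vec d
  /-- the first moment `m̃` -/
  m : Vec d
  /-- the bias-corrected first moment `m̂` -/
  mHat : Vec d
  /-- the second moment `ṽ` -/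
  v : Vec d
  /-- the bias-corrected second moment `v̂` -/
  vHat : Vec d
  /-- the sketch `S` -/
  S : Fin k → Vec d
  /-- the singular vectors `U` -/
  U : Fin k → Vec d
  /-- the diagonal of `Λ` -/
  Λ : Fin k → ℝ

/-- The measurable structure under which all components are (jointly) measurable. -/
instance (d k : ℕ) : MeasurableSpace (State d k) :=
  MeasurableSpace.comap
    (fun s => (s.agg, s.θ, s.m, s.mHat, s.v, s.vHat, s.S, s.U, s.Λ)) inferInstance

/-- The range update `Y`: `ĝ ĝᵀ S` in the first round, `U Λ + ĝ ĝᵀ U` later. -/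
def sketchRange {d k : ℕ} (t : ℕ) (S U : Fin k → Vec d) (Λ : Fin k → ℝ) (g : Vec d) :
    Fin k → Vec d :=
  fun j => if t = 1 then inner ℝ g (S j) • g else Λ j • U j + inner ℝ g (U j) • g

/-- The least number `r` of leading singular vectors that retain the proportion `q` of the energy:
`∑_{i ≤ r} Λᵢ² ≥ q ∑_{i ≤ k} Λᵢ²`. -/
def keptRank {k : ℕ} (q : ℝ) (Λ : Fin k → ℝ) : ℕ :=
  sInf {r : ℕ | r ≤ k ∧ q * ∑ i, Λ i ^ 2 ≤ ∑ i with i.val < r, Λ i ^ 2}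

/-- The new sketch `[U' | Q]`, where `U'` consists of the first `r` columns of `U`, and `Q` is the
`Q`-factor of `(I - U' U'ᵀ) Ω`. Of the `k` columns of `Ω` only the first `k - r` are used (the
first columns of a `Q`-factor depend only on the corresponding columns of the matrix). -/
def newSketch {d k : ℕ} (r : ℕ) (U Ω : Fin k → Vec d) : Fin k → Vec d :=
  fun j => if j.val < r then U j
    else qrQ (fun l => Ω l - ∑ i with i.val < r, inner ℝ (U i) (Ω l) • U i)
      ⟨j.val - r, (Nat.sub_le _ _).trans_lt j.isLt⟩

/-- The noise variance `a² = (N E / B) σ² C²` of each client. -/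
def noiseVar (N E B : ℕ) (σ C : ℝ) : ℝ := (N * E / B : ℝ) * σ ^ 2 * C ^ 2

/-- The clipped sketch `s_i^clip` of client `i`, which has drawn the record position `slot`.
It is `0` if there is no record to process. -/
def clientSketch {d k M N : ℕ} {X : Type*} (C : ℝ) (L : Vec d → X → ℝ) (D : Dataset M N X)
    (st : State d k) (i : Fin M) (slot : Option (Fin N)) : Vec k :=
  match slot.bind (D i) with
  | none => 0
  | some x => normClip C (sketch st.S (gradient (fun θ => L θ x) st.θ - st.mHat))

/-- Round `t = 1, 2, …` of the algorithm: the clients `i` selected in `r` sketch and clip their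
gradients, add the noise `z i`, and the server receives the aggregate, which it uses, together with
the probes `Ω`, to update the model and the sketch. -/
def step {d k M N B : ℕ} {X : Type*} (hp : Hyper) (σ : ℝ) (E : ℕ) (L : Vec d → X → ℝ)
    (D : Dataset M N X) (t : ℕ) (r : Round M N B) (z : Fin M → Vec k) (Ω : Fin k → Vec d)
    (st : State d k) : State d k :=
  let agg : Vec k :=
    (B : ℝ)⁻¹ • ∑ i ∈ r.clients, (clientSketch hp.C L D st i (r.draw i) + z i)
  let g : Vec d := unsketch st.S agg + st.mHat
  let m : Vec d := hp.β₁ • st.m + (1 - hp.β₁) • g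
  let mHat : Vec d := (1 - hp.β₁ ^ t)⁻¹ • m
  let v : Vec d := WithLp.toLp 2 fun c => hp.β₂ * st.v c +
    (1 - hp.β₂) * (g c ^ 2 - noiseVar N E B σ hp.C * ∑ j, st.S j c ^ 2)
  let vHat : Vec d := (1 - hp.β₂ ^ t)⁻¹ • v
  let θ : Vec d := WithLp.toLp 2 fun c =>
    st.θ c - hp.η * (mHat c / Real.sqrt (max (vHat c) hp.γ'))
  let Y := sketchRange t st.S st.U st.Λ g
  let U := qrQ Y
  let Λ : Fin k → ℝ := fun j => Real.sqrt (∑ i, qrR Y i j ^ 2)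
  let S := newSketch (keptRank hp.q Λ) U Ω
  { agg := agg, θ := θ, m := m, mHat := mHat, v := v, vHat := vHat, S := S, U := U, Λ := Λ }

/-- The state before the first round: parameters `θ₀` and the orthonormalized random sketch. -/
def initState {d k : ℕ} (θ₀ : Vec d) (Ω₀ : Fin k → Vec d) : State d k :=
  { agg := 0, θ := θ₀, m := 0, mHat := 0, v := 0, vHat := 0, S := qrQ Ω₀, U := 0, Λ := 0 }

/-- All random choices of a run: the schedule, the initial parameters, the initial Gaussian sketch
matrix, and for every round the noise of each client and the Gaussian probes. -/
abbrev Randomness (d k M N B E : ℕ) :=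
  Schedule M N B E × Vec d × (Fin k → Vec d) × (ℕ → (Fin M → Vec k) × (Fin k → Vec d))

/-- The state after `t` rounds. It no longer changes when all rounds of the schedule are done. -/
def stateAt {d k M N B E : ℕ} {X : Type*} (hp : Hyper) (σ : ℝ) (L : Vec d → X → ℝ)
    (D : Dataset M N X) (ω : Randomness d k M N B E) : ℕ → State d k
  | 0 => initState ω.2.1 ω.2.2.1
  | t + 1 =>
    match ω.1.rounds[t]? with
    | none => stateAt hp σ L D ω t
    | some r =>
      step hp σ E L D (t + 1) r (ω.2.2.2 t).1 (ω.2.2.2 t).2 (stateAt hp σ L D ω t)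

/-- The joint law of all random choices, which are independent: the schedule has law `P`, the
initial parameters have law `μ₀`, each client noise has law `𝒩(0, a²)^k` and the entries of all
sketching matrices are standard Gaussian. -/
def randomnessLaw {d k M N B E : ℕ} (hp : Hyper) (σ : ℝ) (P : Measure (Schedule M N B E))
    (μ₀ : Measure (Vec d)) : Measure (Randomness d k M N B E) :=
  P.prod (μ₀.prod ((Measure.pi fun _ : Fin k => gaussianVec d 1).prod
    (Measure.infinitePi fun _ : ℕ =>
      (Measure.pi fun _ : Fin M => gaussianVec k (noiseVar N E B σ hp.C)).prod
        (Measure.pi fun _ : Fin k => gaussianVec d 1))))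

/-- Algorithm DOME as a randomized mechanism. Its output is everything outside the clients: the
schedule and the whole sequence of aggregates and server states. -/
def dome {d k M N B E : ℕ} {X : Type*} (hp : Hyper) (σ : ℝ) (L : Vec d → X → ℝ)
    (P : Measure (Schedule M N B E)) (μ₀ : Measure (Vec d)) (D : Dataset M N X) :
    Measure (Schedule M N B E × (ℕ → State d k)) :=
  (randomnessLaw hp σ P μ₀).map fun ω => (ω.1, stateAt hp σ L D ω)

end DOME

end

noncomputable section

open scoped ENNReal NNReal

namespace DOME

/-! ### A dual form of Rényi divergence bounds -/

/-! Privacy is proved by Rényi accounting of order `1 + l`, in a dual form that needs no densities.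
If the law of `f` has density `ρ` with respect to that of `g`, Hölder's inequality gives
`HolderDominated` with `K = ‖ρ‖_{1+l}`; thus `log K` is `l / (1 + l)` times the Rényi divergence.
Post-processing is substitution of test functions, and under adaptive composition the constants
multiply (`HolderDominated.prod`).

In a round with a fixed starting state, the data enter only through the sum of the clipped sketches.
If the differing record is drawn, this sum moves by some `Δ` with `‖Δ‖ ≤ C`, because one of the two
contributions is zero. Shifting each of the `B` independent noises by `Δ / B` compensates; the
Gaussian shift bound makes the logarithmic cost `l ‖Δ‖² / (2 B a²)`. Any other round costs nothing
(`holderDominated_step`).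

The record is drawn once per epoch, so by induction over the rounds the total is at most `E l C² /
(2 B a²) = l / (2 N σ²) ≤ l / (2 σ²)` (`holderDominated_output`). Testing with indicators turns this
into an `(ε, δ)` bound (`HolderDominated.measure_preimage_le`), and `l = ε σ² / 2` gives the claimed
`δ` (`exp_conversion_le`). -/

/-- The law of `f` under `Q` is dominated by the law of `g` under `Q` in the sense of Hölder's
inequality. This is the dual form of a bound on the Rényi divergence of order `1 + l`. -/
def HolderDominated {α γ : Type*} [MeasurableSpace α] [MeasurableSpace γ] (l : ℝ) (K : ℝ≥0∞)
    (Q : Measure α) (f g : α → γ) : Prop :=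
  ∀ F : γ → ℝ≥0∞, Measurable F →
    ∫⁻ x, F (f x) ∂Q ≤ K * (∫⁻ x, F (g x) ^ ((1 + l) / l) ∂Q) ^ (l / (1 + l))

section HolderDominated

variable {α β γ τ : Type*} [MeasurableSpace α] [MeasurableSpace β] [MeasurableSpace γ]
  [MeasurableSpace τ] {l : ℝ}

theorem holderConjugate_div (hl : 0 < l) : ((1 + l) / l).HolderConjugate (1 + l) := by
  rw [Real.holderConjugate_iff]
  refine ⟨?_, ?_⟩
  · rw [lt_div_iff₀ hl]; linarith
  · field_simp
    ring

/-- Hölder's inequality against the constant `1`, whose norm is `1` under a probability measure. -/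
theorem HolderDominated.refl (hl : 0 < l) (Q : Measure α) [IsProbabilityMeasure Q] {f : α → γ}
    (hf : Measurable f) : HolderDominated l 1 Q f f := by
  intro F hF
  have h := ENNReal.lintegral_mul_le_Lp_mul_Lq Q (holderConjugate_div hl)
    (hF.comp hf).aemeasurable (aemeasurable_const (b := (1 : ℝ≥0∞)))
  simpa [one_div_div] using h

theorem HolderDominated.mono {K K' : ℝ≥0∞} (hK : K ≤ K') {Q : Measure α} {f g : α → γ}
    (h : HolderDominated l K Q f g) : HolderDominated l K' Q f g :=
  fun F hF => (h F hF).trans (by gcongr)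

theorem HolderDominated.map {K : ℝ≥0∞} {Q : Measure α} {f g : α → γ}
    (h : HolderDominated l K Q f g) {u : γ → τ} (hu : Measurable u) :
    HolderDominated l K Q (fun x => u (f x)) (fun x => u (g x)) :=
  fun F hF => h (fun y => F (u y)) (hF.comp hu)

theorem HolderDominated.comp_measurePreserving {K : ℝ≥0∞} {Q : Measure α} {ρ : Measure β}
    {f g : α → γ} (h : HolderDominated l K Q f g) (hf : Measurable f) (hg : Measurable g)
    {e : β → α} (he : MeasurePreserving e ρ Q) :
    HolderDominated l K ρ (fun x => f (e x)) (fun x => g (e x)) := by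
  intro F hF
  have h1 := he.lintegral_comp (f := fun x => F (f x)) (hF.comp hf)
  have h2 := he.lintegral_comp (f := fun x => F (g x) ^ ((1 + l) / l))
    ((hF.comp hg).pow_const _)
  rw [h1, h2]
  exact h F hF

/-- Adaptive composition. -/
theorem HolderDominated.prod (hl : 0 < l) {K₁ K₂ : ℝ≥0∞} {Q : Measure α} {ρ : Measure β}
    [SFinite Q] [SFinite ρ] {f g : α → γ} {u w : γ → β → τ} (h₁ : HolderDominated l K₁ Q f g)
    (h₂ : ∀ y, HolderDominated l K₂ ρ (u y) (w y)) (hf : Measurable f) (hg : Measurable g)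
    (hu : Measurable fun p : γ × β => u p.1 p.2) (hw : Measurable fun p : γ × β => w p.1 p.2) :
    HolderDominated l (K₁ * K₂) (Q.prod ρ) (fun p => u (f p.1) p.2) (fun p => w (g p.1) p.2) := by
  intro F hF
  have hp : (l / (1 + l)) * ((1 + l) / l) = 1 := by
    field_simp
  have mw : Measurable fun y => ∫⁻ b, F (w y b) ^ ((1 + l) / l) ∂ρ :=
    Measurable.lintegral_prod_right' (f := fun p : γ × β => F (w p.1 p.2) ^ ((1 + l) / l))
      ((hF.comp hw).pow_const _)
  have m1 : Measurable fun p : α × β => F (u (f p.1) p.2) :=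
    hF.comp (hu.comp ((hf.comp measurable_fst).prodMk measurable_snd))
  have m2 : Measurable fun p : α × β => F (w (g p.1) p.2) ^ ((1 + l) / l) :=
    (hF.comp (hw.comp ((hg.comp measurable_fst).prodMk measurable_snd))).pow_const _
  rw [lintegral_prod _ m1.aemeasurable, lintegral_prod _ m2.aemeasurable]
  calc ∫⁻ a, ∫⁻ b, F (u (f a) b) ∂ρ ∂Q
      ≤ ∫⁻ a, K₂ * (∫⁻ b, F (w (f a) b) ^ ((1 + l) / l) ∂ρ) ^ (l / (1 + l)) ∂Q :=
        lintegral_mono fun a => h₂ (f a) F hF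
    _ = K₂ * ∫⁻ a, (∫⁻ b, F (w (f a) b) ^ ((1 + l) / l) ∂ρ) ^ (l / (1 + l)) ∂Q :=
        lintegral_const_mul _ ((mw.comp hf).pow_const _)
    -- The inner `L^p` norm, as a function of the intermediate value, is the test function for `h₁`;
    -- the outer power then cancels the root.
    _ ≤ K₂ * (K₁ * (∫⁻ a, ((∫⁻ b, F (w (g a) b) ^ ((1 + l) / l) ∂ρ) ^ (l / (1 + l))) ^
          ((1 + l) / l) ∂Q) ^ (l / (1 + l))) := by
        gcongr
        exact h₁ _ (mw.pow_const _)
    _ = _ := by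
        simp_rw [← ENNReal.rpow_mul, hp, ENNReal.rpow_one]
        ring

/-- Randomness shared by both runs can be conditioned on at no cost. -/
theorem HolderDominated.prod_fiber (hl : 0 < l) {K : ℝ≥0∞} {Q : Measure α} {ρ : Measure β}
    [IsProbabilityMeasure Q] [SFinite ρ] {u w : α → β → τ}
    (h : ∀ y, HolderDominated l K ρ (u y) (w y))
    (hu : Measurable fun p : α × β => u p.1 p.2) (hw : Measurable fun p : α × β => w p.1 p.2) :
    HolderDominated l K (Q.prod ρ) (fun p => u p.1 p.2) (fun p => w p.1 p.2) := by
  have := HolderDominated.prod hl (HolderDominated.refl hl Q measurable_id) h measurable_id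
    measurable_id hu hw
  simpa using this

theorem HolderDominated.prod_map (hl : 0 < l) {K₁ K₂ : ℝ≥0∞} {Q : Measure α} {ρ : Measure β}
    [SFinite Q] [SFinite ρ] {f : α → α} {g : β → β} (h₁ : HolderDominated l K₁ Q f id)
    (h₂ : HolderDominated l K₂ ρ g id) (hf : Measurable f) (hg : Measurable g) :
    HolderDominated l (K₁ * K₂) (Q.prod ρ) (Prod.map f g) id :=
  HolderDominated.prod hl h₁ (u := fun a b => (a, g b)) (w := fun a b => (a, b))
    (fun y => h₂.map (u := fun b => (y, b)) measurable_prodMk_left) hf measurable_id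
    (measurable_fst.prodMk (hg.comp measurable_snd)) measurable_id

theorem HolderDominated.pi (hl : 0 < l) {n : ℕ} {K : Fin n → ℝ≥0∞} {Q : Fin n → Measure α}
    [∀ i, IsProbabilityMeasure (Q i)] {f : Fin n → α → α} (hf : ∀ i, Measurable (f i))
    (h : ∀ i, HolderDominated l (K i) (Q i) (f i) id) :
    HolderDominated l (∏ i, K i) (Measure.pi Q) (fun x i => f i (x i)) id := by
  induction n with
  | zero =>
    have : (fun (x : Fin 0 → α) i => f i (x i)) = id := by
      funext x i; exact i.elim0
    rw [this]
    simpa using HolderDominated.refl hl (Measure.pi Q) measurable_id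
  | succ n ih =>
    have h1 := HolderDominated.prod_map hl (h 0)
      (ih (Q := fun j => Q j.succ) (fun i => hf i.succ) fun i => h i.succ) (hf 0)
      (by fun_prop)
    have he := measurePreserving_piFinSuccAbove (fun i => Q i) 0
    have h2 := (h1.map (MeasurableEquiv.piFinSuccAbove (fun _ => α) 0).symm.measurable)
    have h3 := h2.comp_measurePreserving
      ((MeasurableEquiv.piFinSuccAbove (fun _ => α) 0).symm.measurable.comp
        (by have := hf 0; fun_prop)) (by fun_prop) he
    rw [Fin.prod_univ_succ]
    convert h3 using 2 with x x
    · rw [eq_comm, MeasurableEquiv.symm_apply_eq]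
      rfl
    · exact (MeasurableEquiv.symm_apply_apply _ x).symm

/-! ### Gaussian shifts. -/

theorem lintegral_exp_mul_gaussianReal (v : ℝ≥0) (t : ℝ) :
    ∫⁻ x, ENNReal.ofReal (Real.exp (t * x)) ∂gaussianReal 0 v
      = ENNReal.ofReal (Real.exp (v * t ^ 2 / 2)) := by
  rw [← ofReal_integral_eq_lintegral_ofReal (integrable_exp_mul_gaussianReal t)
    (Filter.Eventually.of_forall fun x => (Real.exp_pos _).le)]
  have := mgf_gaussianReal (p := gaussianReal 0 v) (X := id) (μ := 0) (v := v) (by simp) t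
  simp only [mgf, id] at this
  rw [this]; simp

theorem holderDominated_gaussianReal (hl : 0 < l) {v : ℝ≥0} (hv : v ≠ 0) (s : ℝ) :
    HolderDominated l (ENNReal.ofReal (Real.exp (l * s ^ 2 / (2 * v)))) (gaussianReal 0 v)
      (fun x => x + s) id := by
  intro F hF
  have hv' : (0 : ℝ) < v := by positivity
  have h1 : ∫⁻ x, F (x + s) ∂gaussianReal 0 v = ∫⁻ x, F x ∂gaussianReal s v := by
    rw [← zero_add s, ← gaussianReal_map_add_const, lintegral_map hF (by fun_prop)]
    simp
  -- The likelihood ratio of `𝒩(s, v)` to `𝒩(0, v)` is `exp ((s x - s² / 2) / v)`.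
  have h2 : ∫⁻ x, F x ∂gaussianReal s v = ∫⁻ x, (F *
      fun x => ENNReal.ofReal (Real.exp ((s * x - s ^ 2 / 2) / v))) x ∂gaussianReal 0 v := by
    rw [gaussianReal_of_var_ne_zero _ hv, gaussianReal_of_var_ne_zero _ hv,
      lintegral_withDensity_eq_lintegral_mul _ (measurable_gaussianPDF _ _) hF,
      lintegral_withDensity_eq_lintegral_mul _ (measurable_gaussianPDF _ _)
        (hF.mul (by fun_prop))]
    refine lintegral_congr fun x => ?_
    simp only [Pi.mul_apply, gaussianPDF, gaussianPDFReal]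
    rw [mul_left_comm, ← ENNReal.ofReal_mul (by positivity), mul_assoc _ (Real.exp _),
      ← Real.exp_add, mul_comm]
    congr 4
    field_simp
    ring
  -- The `(1 + l)`-norm of this ratio: the Gaussian moment generating function contributes `(1 + l)²
  -- s² / (2v)` and the constant factor `-(1 + l) s² / (2v)`; the root divides the sum by `1 + l`.
  have h3 : (∫⁻ x, ENNReal.ofReal (Real.exp ((s * x - s ^ 2 / 2) / v)) ^ (1 + l)
      ∂gaussianReal 0 v) ^ (1 / (1 + l)) = ENNReal.ofReal (Real.exp (l * s ^ 2 / (2 * v))) := by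
    have e : ∀ x : ℝ, ENNReal.ofReal (Real.exp ((s * x - s ^ 2 / 2) / v)) ^ (1 + l) =
        ENNReal.ofReal (Real.exp (-(1 + l) * s ^ 2 / (2 * v))) *
          ENNReal.ofReal (Real.exp ((1 + l) * s / v * x)) := by
      intro x
      rw [ENNReal.ofReal_rpow_of_pos (Real.exp_pos _), ← Real.exp_mul,
        ← ENNReal.ofReal_mul (by positivity), ← Real.exp_add]
      congr 2
      field_simp
      ring
    simp_rw [e]
    rw [lintegral_const_mul _ (by fun_prop), lintegral_exp_mul_gaussianReal,
      ← ENNReal.ofReal_mul (by positivity), ← Real.exp_add,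
      ENNReal.ofReal_rpow_of_pos (Real.exp_pos _), ← Real.exp_mul]
    congr 2
    field_simp
    ring
  rw [h1, h2, ← h3]
  have := ENNReal.lintegral_mul_le_Lp_mul_Lq (gaussianReal 0 v) (holderConjugate_div hl)
    hF.aemeasurable (g := fun x => ENNReal.ofReal (Real.exp ((s * x - s ^ 2 / 2) / v)))
    (by fun_prop)
  rw [mul_comm (_ ^ _)]
  simpa [one_div_div] using this

instance (d : ℕ) (v : ℝ) : IsProbabilityMeasure (gaussianVec d v) := by
  unfold gaussianVec
  exact Measure.isProbabilityMeasure_map (by fun_prop)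

/-- The coordinates are independent, so their exponents add up to the squared Euclidean norm. -/
theorem holderDominated_gaussianVec (hl : 0 < l) {v : ℝ} (hv : 0 < v) {d : ℕ} (s : Vec d) :
    HolderDominated l (ENNReal.ofReal (Real.exp (l * ‖s‖ ^ 2 / (2 * v)))) (gaussianVec d v)
      (fun x => x + s) id := by
  have hv' : v.toNNReal ≠ 0 := by simpa using hv
  have h := (HolderDominated.pi hl (fun i => by fun_prop)
    fun i : Fin d => holderDominated_gaussianReal hl hv' (s i)).map
      (u := WithLp.toLp 2) (τ := Vec d) (by fun_prop)
  rw [← ENNReal.ofReal_prod_of_nonneg (fun i _ => (Real.exp_pos _).le), ← Real.exp_sum,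
    ← Finset.sum_div, ← Finset.mul_sum, Real.coe_toNNReal _ hv.le] at h
  rw [EuclideanSpace.real_norm_sq_eq]
  intro F hF
  have := h F hF
  unfold gaussianVec
  rw [lintegral_map (by fun_prop) (by fun_prop), lintegral_map (by fun_prop) (by fun_prop)]
  exact this

/-- Conversion to an `(ε, δ)` bound, by the weighted inequality between the arithmetic and the
geometric mean. -/
theorem HolderDominated.measure_preimage_le (hl : 0 < l) {c ε δ : ℝ} {Q : Measure α}
    [IsProbabilityMeasure Q] {f g : α → γ}
    (h : HolderDominated l (ENNReal.ofReal (Real.exp c)) Q f g) (hf : Measurable f)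
    (hg : Measurable g) (hδ : Real.exp ((1 + l) * c - l * ε) ≤ δ) {A : Set γ}
    (hA : MeasurableSet A) :
    Q (f ⁻¹' A) ≤ ENNReal.ofReal (Real.exp ε) * Q (g ⁻¹' A) + ENNReal.ofReal δ := by
  have h1 : ∫⁻ x, A.indicator 1 (f x) ∂Q = Q (f ⁻¹' A) := by
    rw [← lintegral_indicator_one (hf hA)]; rfl
  have h2 : ∫⁻ x, (A.indicator 1 (g x) : ℝ≥0∞) ^ ((1 + l) / l) ∂Q = Q (g ⁻¹' A) := by
    rw [← lintegral_indicator_one (hg hA)]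
    refine lintegral_congr fun x => ?_
    by_cases hx : g x ∈ A
    · simp [Set.indicator, hx]
    · have : 0 < (1 + l) / l := by positivity
      simp [Set.indicator, hx, this]
  -- An indicator equals its own positive powers, so the bound reads `Q(f ∈ A) ≤ e^c Q(g ∈ A)^(l /
  -- (1 + l))`.
  have h3 := h (A.indicator 1) (measurable_one.indicator hA)
  rw [h1, h2] at h3
  refine h3.trans ?_
  set x := (Q (g ⁻¹' A)).toReal with hx
  have hx0 : 0 ≤ x := ENNReal.toReal_nonneg
  have hxe : Q (g ⁻¹' A) = ENNReal.ofReal x := by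
    rw [hx, ENNReal.ofReal_toReal (measure_ne_top _ _)]
  have hδ0 : 0 ≤ δ := (Real.exp_pos _).le.trans hδ
  rw [hxe, ENNReal.ofReal_rpow_of_nonneg hx0 (by positivity),
    ← ENNReal.ofReal_mul (by positivity), ← ENNReal.ofReal_mul (by positivity),
    ← ENNReal.ofReal_add (by positivity) hδ0]
  refine ENNReal.ofReal_le_ofReal ?_
  -- The factor `e^ε` is moved into the first mean; the second point is whatever makes the product
  -- `e^c x^(l / (1 + l))` again. Both weights are then bounded by `1`.
  have hw := Real.geom_mean_le_arith_mean2_weighted (w₁ := l / (1 + l)) (w₂ := 1 / (1 + l))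
    (p₁ := Real.exp ε * x) (p₂ := Real.exp ((1 + l) * c - l * ε)) (by positivity) (by positivity)
    (by positivity) (by positivity) (by field_simp; ring)
  have e : (Real.exp ε * x) ^ (l / (1 + l)) * Real.exp ((1 + l) * c - l * ε) ^ (1 / (1 + l)) =
      Real.exp c * x ^ (l / (1 + l)) := by
    rw [Real.mul_rpow (by positivity) hx0, ← Real.exp_mul, ← Real.exp_mul, mul_right_comm,
      ← Real.exp_add]
    congr 2
    field_simp
    ring
  rw [e] at hw
  refine hw.trans (add_le_add ?_ (le_trans ?_ hδ))
  · refine mul_le_of_le_one_left (by positivity) ?_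
    rw [div_le_one (by positivity)]; linarith
  · refine mul_le_of_le_one_left (by positivity) ?_
    rw [div_le_one (by positivity)]; linarith

end HolderDominated

/-! ### Sequences of independent variables -/

/-- Separates the randomness of the first round from the rest. The inverse map, which prepends an
entry, is checked on boxes. -/
theorem measurePreserving_infinitePi_nat_cases {W : Type*} [MeasurableSpace W] (ρ : Measure W)
    [IsProbabilityMeasure ρ] :
    MeasurePreserving (fun ω : ℕ → W => (ω 0, fun n => ω (n + 1)))
      (Measure.infinitePi fun _ : ℕ => ρ) (ρ.prod (Measure.infinitePi fun _ : ℕ => ρ)) := by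
  have hc : Measurable fun p : W × (ℕ → W) => (fun n => Nat.casesOn n p.1 p.2 : ℕ → W) := by
    refine measurable_pi_lambda _ fun n => ?_
    cases n with
    | zero => exact measurable_fst
    | succ n => exact (measurable_pi_apply n).comp measurable_snd
  have h : (ρ.prod (Measure.infinitePi fun _ : ℕ => ρ)).map
      (fun p : W × (ℕ → W) => (fun n => Nat.casesOn n p.1 p.2 : ℕ → W)) =
        Measure.infinitePi fun _ : ℕ => ρ := by
    refine Measure.eq_infinitePi _ fun s t ht => ?_
    classical
    obtain ⟨N, hN⟩ : ∃ N, s ⊆ Finset.range (N + 1) :=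
      ⟨s.sup id, fun i hi => Finset.mem_range_succ_iff.2 (Finset.le_sup (f := id) hi)⟩
    -- Padding with `univ` turns a box over any finite index set into one over an initial segment,
    -- where the factor at `0` splits off.
    set t' : ℕ → Set W := fun n => if n ∈ s then t n else Set.univ with ht'
    have mt' : ∀ n, MeasurableSet (t' n) := fun n => by
      by_cases hn : n ∈ s <;> simp [ht', hn, ht n]
    have hpre : (fun p : W × (ℕ → W) => (fun n => Nat.casesOn n p.1 p.2 : ℕ → W)) ⁻¹'
        Set.pi s t = t' 0 ×ˢ Set.pi (Finset.range N) (fun n => t' (n + 1)) := by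
      ext p
      simp only [Set.mem_preimage, Set.mem_pi, Set.mem_prod, Finset.mem_coe, Finset.mem_range, ht']
      constructor
      · intro h
        refine ⟨?_, fun n _ => ?_⟩
        · split_ifs with h0
          · exact h 0 h0
          · trivial
        · split_ifs with h0
          · exact h (n + 1) h0
          · trivial
      · rintro ⟨h0, h1⟩ n hn
        cases n with
        | zero => simpa [hn] using h0
        | succ n =>
          have := h1 n (by simpa using hN hn)
          simpa [hn] using this
    rw [Measure.map_apply hc (MeasurableSet.pi s.countable_toSet fun i _ => ht i), hpre,
      Measure.prod_prod, Measure.infinitePi_pi _ fun n _ => mt' (n + 1), mul_comm,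
      ← Finset.prod_range_succ' (fun n => ρ (t' n)), ← Finset.prod_subset hN]
    · exact Finset.prod_congr rfl fun n hn => by simp [ht', hn]
    · intro n _ hn
      simp [ht', hn]
  have hm : Measurable fun ω : ℕ → W => (ω 0, fun n => ω (n + 1)) := by fun_prop
  refine ⟨hm, ?_⟩
  conv_lhs => rw [← h]
  rw [Measure.map_map hm hc]
  exact Measure.map_id

/-! ### Measurability of the algorithm -/

section Measurability

variable {α : Type*} [MeasurableSpace α] {d k : ℕ}

theorem measurable_residualVec {j : ℕ} {q : α → Fin j → Vec d} {v : α → Vec d}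
    (hq : Measurable q) (hv : Measurable v) : Measurable fun a => residualVec (q a) (v a) := by
  unfold residualVec
  fun_prop

theorem measurable_unitVec : Measurable (unitVec : Vec d → Vec d) := by
  unfold unitVec
  fun_prop

theorem measurable_find?_elim {ι β : Type*} [MeasurableSpace β] (l : List ι)
    {p : α → ι → Bool} (hp : ∀ i, MeasurableSet {a | p a i = true})
    {f : ι → α → β} (hf : ∀ i, Measurable (f i)) (b : β) :
    Measurable fun a => (l.find? (p a)).elim b fun i => f i a := by
  induction l with
  | nil => exact measurable_const
  | cons i l ih =>
    have h : Measurable fun a =>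
        if p a i = true then f i a else (l.find? (p a)).elim b fun i => f i a :=
      Measurable.ite (hp i) (hf i) ih
    convert h using 2 with a
    by_cases h : p a i <;> simp [h]

open Classical in
-- Replaces the `match` by `Option.elim`, the form that `measurable_find?_elim` handles.
theorem nextColumn_eq {j : ℕ} (q : Fin j → Vec d) (y : Vec d) :
    nextColumn q y = if residualVec q y ≠ 0 then unitVec (residualVec q y)
      else ((List.finRange d).find? fun c =>
        residualVec q (EuclideanSpace.single c 1) ≠ 0).elim 0
          fun c => unitVec (residualVec q (EuclideanSpace.single c 1)) := by
  unfold nextColumn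
  congr 1
  split <;> rename_i h <;> rw [h] <;> rfl

theorem measurable_nextColumn {j : ℕ} {q : α → Fin j → Vec d} {y : α → Vec d}
    (hq : Measurable q) (hy : Measurable y) : Measurable fun a => nextColumn (q a) (y a) := by
  classical
  have h0 : MeasurableSet {x : Vec d | x ≠ 0} := (measurableSet_singleton 0).compl
  simp only [nextColumn_eq]
  refine Measurable.ite ((measurable_residualVec hq hy) h0)
    (measurable_unitVec.comp (measurable_residualVec hq hy)) ?_
  refine measurable_find?_elim _
    (p := fun a c => decide (residualVec (q a) (EuclideanSpace.single c 1) ≠ 0)) (fun c => ?_)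
    (fun c => measurable_unitVec.comp (measurable_residualVec hq measurable_const)) 0
  simp only [decide_eq_true_eq]
  exact (measurable_residualVec hq (measurable_const (a := EuclideanSpace.single c 1))) h0

theorem measurable_qrQ_apply {p : ℕ} (n : ℕ) (hn : n < p) :
    Measurable fun Y : Fin p → Vec d => qrQ Y ⟨n, hn⟩ := by
  induction n using Nat.strong_induction_on with
  | _ n ih =>
    have h : (fun Y : Fin p → Vec d => qrQ Y ⟨n, hn⟩) = fun Y =>
        nextColumn (fun i : Fin n => qrQ Y ⟨i.val, i.isLt.trans hn⟩) (Y ⟨n, hn⟩) := by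
      funext Y; rw [qrQ]
    rw [h]
    exact measurable_nextColumn
      (measurable_pi_lambda _ fun i => ih i i.isLt (i.isLt.trans hn)) (measurable_pi_apply _)

theorem measurable_qrQ {p : ℕ} : Measurable (qrQ : (Fin p → Vec d) → Fin p → Vec d) :=
  measurable_pi_lambda _ fun j => measurable_qrQ_apply j.val j.isLt

theorem measurable_qrR {p : ℕ} (i j : Fin p) :
    Measurable fun Y : Fin p → Vec d => qrR Y i j := by
  unfold qrR
  have := measurable_qrQ_apply (d := d) i.val i.isLt
  fun_prop

/-- The rank depends only on the truth values of `k + 1` inequalities, and every function on that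
finite type is measurable. -/
theorem measurable_keptRank (q : ℝ) : Measurable (keptRank q : (Fin k → ℝ) → ℕ) := by
  let P : (Fin k → ℝ) → Fin (k + 1) → Prop :=
    fun Λ r => q * ∑ i, Λ i ^ 2 ≤ ∑ i with i.val < r.val, Λ i ^ 2
  have hP : Measurable P := measurable_pi_lambda _ fun r =>
    measurableSet_setOfPred.1 (measurableSet_le (by fun_prop) (by fun_prop))
  let G : (Fin (k + 1) → Prop) → ℕ := fun T => sInf {r : ℕ | ∃ h : r < k + 1, T ⟨r, h⟩}
  have hG : Measurable G := measurable_of_countable G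
  have : (keptRank q : (Fin k → ℝ) → ℕ) = G ∘ P := by
    funext Λ
    simp only [keptRank, G, P, Function.comp, Nat.lt_succ_iff, exists_prop]
  rw [this]
  exact hG.comp hP

theorem measurable_newSketch {r : α → ℕ} {U Ω : α → Fin k → Vec d} (hr : Measurable r)
    (hU : Measurable U) (hΩ : Measurable Ω) :
    Measurable fun a => newSketch (r a) (U a) (Ω a) := by
  have h : Measurable fun p : ℕ × ((Fin k → Vec d) × (Fin k → Vec d)) =>
      newSketch p.1 p.2.1 p.2.2 := by
    -- The rank takes countably many values, so it may be frozen.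
    refine measurable_from_prod_countable_right fun n => measurable_pi_lambda _ fun j => ?_
    simp only [newSketch]
    split_ifs
    · fun_prop
    · have h : Measurable fun p : (Fin k → Vec d) × (Fin k → Vec d) => fun l =>
          p.2 l - ∑ i with i.val < n, inner ℝ (p.1 i) (p.2 l) • p.1 i := by
        fun_prop
      exact (measurable_qrQ_apply (j.val - n) ((Nat.sub_le _ _).trans_lt j.isLt)).comp h
  exact h.comp (hr.prodMk (hU.prodMk hΩ))

theorem measurable_normClip (C : ℝ) : Measurable (normClip C : Vec k → Vec k) := by
  unfold normClip
  fun_prop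

/-- The derivative of an arbitrary function, read as `0` where it does not exist, is Borel; hence no
regularity of the loss is needed. -/
theorem measurable_gradient (f : Vec d → ℝ) : Measurable (gradient f) := by
  unfold gradient
  exact (InnerProductSpace.toDual ℝ (Vec d)).symm.continuous.measurable.comp
    (measurable_fderiv ℝ f)

theorem State.measurable_iff {f : α → State d k} :
    Measurable f ↔ Measurable fun a => ((f a).agg, (f a).θ, (f a).m, (f a).mHat, (f a).v,
      (f a).vHat, (f a).S, (f a).U, (f a).Λ) :=
  measurable_comap_iff

theorem State.measurable_tuple : Measurable fun s : State d k =>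
    (s.agg, s.θ, s.m, s.mHat, s.v, s.vHat, s.S, s.U, s.Λ) :=
  comap_measurable _

variable {M N B : ℕ} {X : Type*}

theorem measurable_clientSketch (C : ℝ) (L : Vec d → X → ℝ) (D : Dataset M N X) (i : Fin M)
    (slot : Option (Fin N)) :
    Measurable fun st : State d k => clientSketch C L D st i slot := by
  unfold clientSketch
  cases slot.bind (D i) with
  | none => exact measurable_const
  | some x =>
    have hg := measurable_gradient fun θ => L θ x
    have hT := State.measurable_tuple (d := d) (k := k)
    have hθ : Measurable fun st : State d k => st.θ := hT.snd.fst
    have hm : Measurable fun st : State d k => st.mHat := hT.snd.snd.snd.fst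
    have hS : Measurable fun st : State d k => st.S := hT.snd.snd.snd.snd.snd.snd.fst
    have hgθ : Measurable fun st : State d k => gradient (fun θ => L θ x) st.θ := hg.comp hθ
    refine (measurable_normClip C).comp ?_
    unfold sketch
    fun_prop

/-- The update of the server in round `t`, in terms of the aggregate it receives; `a` is the noise
variance. -/
def serverUpdate (hp : Hyper) (a : ℝ) (t : ℕ) (st : State d k) (agg : Vec k)
    (Ω : Fin k → Vec d) : State d k :=
  let g : Vec d := unsketch st.S agg + st.mHat
  let m : Vec d := hp.β₁ • st.m + (1 - hp.β₁) • g
  let mHat : Vec d := (1 - hp.β₁ ^ t)⁻¹ • m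
  let v : Vec d := WithLp.toLp 2 fun c => hp.β₂ * st.v c +
    (1 - hp.β₂) * (g c ^ 2 - a * ∑ j, st.S j c ^ 2)
  let vHat : Vec d := (1 - hp.β₂ ^ t)⁻¹ • v
  let θ : Vec d := WithLp.toLp 2 fun c =>
    st.θ c - hp.η * (mHat c / Real.sqrt (max (vHat c) hp.γ'))
  let Y := sketchRange t st.S st.U st.Λ g
  let U := qrQ Y
  let Λ : Fin k → ℝ := fun j => Real.sqrt (∑ i, qrR Y i j ^ 2)
  let S := newSketch (keptRank hp.q Λ) U Ω
  { agg := agg, θ := θ, m := m, mHat := mHat, v := v, vHat := vHat, S := S, U := U, Λ := Λ }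

/-- Given the current state, the data act only through the aggregate; everything after it is
post-processing. -/
theorem step_eq_serverUpdate (hp : Hyper) (σ : ℝ) (E : ℕ) (L : Vec d → X → ℝ) (D : Dataset M N X)
    (t : ℕ) (r : Round M N B) (z : Fin M → Vec k) (Ω : Fin k → Vec d) (st : State d k) :
    step hp σ E L D t r z Ω st = serverUpdate hp (noiseVar N E B σ hp.C) t st
      ((B : ℝ)⁻¹ • ∑ i ∈ r.clients, (clientSketch hp.C L D st i (r.draw i) + z i)) Ω :=
  rfl

theorem measurable_serverUpdate (hp : Hyper) (a : ℝ) (t : ℕ) :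
    Measurable fun p : State d k × Vec k × (Fin k → Vec d) =>
      serverUpdate hp a t p.1 p.2.1 p.2.2 := by
  let A := State d k × Vec k × (Fin k → Vec d)
  have hT := (State.measurable_tuple (d := d) (k := k)).comp
    (measurable_fst : Measurable fun p : A => p.1)
  have hθ : Measurable fun p : A => p.1.θ := hT.snd.fst
  have hm : Measurable fun p : A => p.1.m := hT.snd.snd.fst
  have hmH : Measurable fun p : A => p.1.mHat := hT.snd.snd.snd.fst
  have hv : Measurable fun p : A => p.1.v := hT.snd.snd.snd.snd.fst
  have hS : Measurable fun p : A => p.1.S := hT.snd.snd.snd.snd.snd.snd.fst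
  have hU : Measurable fun p : A => p.1.U := hT.snd.snd.snd.snd.snd.snd.snd.fst
  have hΛ : Measurable fun p : A => p.1.Λ := hT.snd.snd.snd.snd.snd.snd.snd.snd
  have hg : Measurable fun p : A => unsketch p.1.S p.2.1 + p.1.mHat := by
    unfold unsketch
    fun_prop
  have hY : Measurable fun p : A =>
      sketchRange t p.1.S p.1.U p.1.Λ (unsketch p.1.S p.2.1 + p.1.mHat) := by
    refine measurable_pi_lambda _ fun j => ?_
    unfold sketchRange
    split_ifs <;> fun_prop
  have hR : Measurable fun p : A => fun j : Fin k => Real.sqrt (∑ i, qrR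
      (sketchRange t p.1.S p.1.U p.1.Λ (unsketch p.1.S p.2.1 + p.1.mHat)) i j ^ 2) :=
    measurable_pi_lambda _ fun j => Measurable.sqrt <|
      Finset.measurable_sum _ fun i _ => ((measurable_qrR i j).comp hY).pow_const 2
  have hQ := measurable_qrQ.comp hY
  rw [State.measurable_iff]
  dsimp only [serverUpdate]
  refine Measurable.prodMk (by fun_prop) (Measurable.prodMk (by fun_prop) (Measurable.prodMk
    (by fun_prop) (Measurable.prodMk (by fun_prop) (Measurable.prodMk (by fun_prop)
      (Measurable.prodMk (by fun_prop) (Measurable.prodMk ?_ (hQ.prodMk hR)))))))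
  exact measurable_newSketch ((measurable_keptRank _).comp hR) hQ (by fun_prop)

theorem measurable_step (hp : Hyper) (σ : ℝ) (E : ℕ) (L : Vec d → X → ℝ) (D : Dataset M N X)
    (t : ℕ) (r : Round M N B) {st : α → State d k} {z : α → Fin M → Vec k}
    {Ω : α → Fin k → Vec d} (hst : Measurable st) (hz : Measurable z) (hΩ : Measurable Ω) :
    Measurable fun a => step hp σ E L D t r (z a) (Ω a) (st a) := by
  have hc : ∀ i, Measurable fun a => clientSketch hp.C L D (st a) i (r.draw i) :=
    fun i => (measurable_clientSketch hp.C L D i (r.draw i)).comp hst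
  have h : Measurable fun a =>
      (B : ℝ)⁻¹ • ∑ i ∈ r.clients, (clientSketch hp.C L D (st a) i (r.draw i) + z a i) := by
    fun_prop
  simp only [step_eq_serverUpdate]
  exact (measurable_serverUpdate hp _ t).comp (hst.prodMk (h.prodMk hΩ))

end Measurability

/-! ### Runs from a given state -/

variable {d k M N B E : ℕ} {X : Type*}

/-- The state after `n` of the rounds in `rs`, run from the state `st` that is reached after `t`
rounds. -/
def stateFrom (hp : Hyper) (σ : ℝ) (E : ℕ) (L : Vec d → X → ℝ) (D : Dataset M N X)
    (rs : List (Round M N B)) (t : ℕ) (st : State d k)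
    (ω : ℕ → (Fin M → Vec k) × (Fin k → Vec d)) : ℕ → State d k
  | 0 => st
  | n + 1 =>
    match rs[n]? with
    | none => stateFrom hp σ E L D rs t st ω n
    | some r => step hp σ E L D (n + t + 1) r (ω n).1 (ω n).2 (stateFrom hp σ E L D rs t st ω n)

theorem stateAt_eq_stateFrom (hp : Hyper) (σ : ℝ) (L : Vec d → X → ℝ) (D : Dataset M N X)
    (ω : Randomness d k M N B E) (n : ℕ) :
    stateAt hp σ L D ω n =
      stateFrom hp σ E L D ω.1.rounds 0 (initState ω.2.1 ω.2.2.1) ω.2.2.2 n := by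
  induction n with
  | zero => rfl
  | succ n ih =>
    rw [stateAt, stateFrom, ih]

theorem stateFrom_nil (hp : Hyper) (σ : ℝ) (L : Vec d → X → ℝ) (D : Dataset M N X) (t : ℕ)
    (st : State d k) (ω : ℕ → (Fin M → Vec k) × (Fin k → Vec d)) :
    stateFrom hp σ E L D ([] : List (Round M N B)) t st ω = fun _ => st := by
  funext n
  induction n with
  | zero => rfl
  | succ n ih => rw [stateFrom]; exact ih

/-- Definitionally a run is extended at its end; induction over the list of rounds needs the first
round peeled off instead. -/
theorem stateFrom_cons (hp : Hyper) (σ : ℝ) (L : Vec d → X → ℝ) (D : Dataset M N X)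
    (r : Round M N B) (rs : List (Round M N B)) (t : ℕ) (st : State d k)
    (ω : ℕ → (Fin M → Vec k) × (Fin k → Vec d)) (n : ℕ) :
    stateFrom hp σ E L D (r :: rs) t st ω (n + 1) = stateFrom hp σ E L D rs (t + 1)
      (step hp σ E L D (t + 1) r (ω 0).1 (ω 0).2 st) (fun m => ω (m + 1)) n := by
  induction n with
  | zero => simp [stateFrom]
  | succ n ih =>
    rw [stateFrom, ih, stateFrom, List.getElem?_cons_succ, show n + 1 + t + 1 = n + (t + 1) + 1 by
      omega]

theorem measurable_stateFrom (hp : Hyper) (σ : ℝ) (E : ℕ) (L : Vec d → X → ℝ)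
    (D : Dataset M N X) (rs : List (Round M N B)) (t : ℕ) :
    Measurable fun p : State d k × (ℕ → (Fin M → Vec k) × (Fin k → Vec d)) =>
      stateFrom hp σ E L D rs t p.1 p.2 := by
  refine measurable_pi_lambda _ fun n => ?_
  induction n with
  | zero => exact measurable_fst
  | succ n ih =>
    simp only [stateFrom]
    cases rs[n]? with
    | none => exact ih
    | some r =>
      have hω : Measurable fun p : State d k × (ℕ → (Fin M → Vec k) × (Fin k → Vec d)) => p.2 n :=
        (measurable_pi_apply n).comp measurable_snd
      exact measurable_step hp σ E L D (n + t + 1) r ih hω.fst hω.snd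

/-! ### One round -/

theorem norm_normClip_le {C : ℝ} (hC : 0 ≤ C) (s : Vec k) : ‖normClip C s‖ ≤ C := by
  unfold normClip
  have h0 : 0 ≤ min 1 (C / ‖s‖) := le_min zero_le_one (by positivity)
  rw [norm_smul, Real.norm_of_nonneg h0]
  rcases eq_or_ne ‖s‖ 0 with h | h
  -- For `s = 0` the convention `C / 0 = 0` is harmless.
  · simpa [h] using hC
  · calc min 1 (C / ‖s‖) * ‖s‖ ≤ C / ‖s‖ * ‖s‖ := by gcongr; exact min_le_right _ _
      _ = C := by field_simp

theorem norm_clientSketch_le {C : ℝ} (hC : 0 ≤ C) (L : Vec d → X → ℝ) (D : Dataset M N X)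
    (st : State d k) (i : Fin M) (slot : Option (Fin N)) :
    ‖clientSketch C L D st i slot‖ ≤ C := by
  unfold clientSketch
  split
  · simpa using hC
  · exact norm_normClip_le hC _

/-- Since adjacency adds or removes a record, one of the two sketches vanishes: the sensitivity is
`C` rather than `2C`. -/
theorem norm_clientSketch_sub_le {C : ℝ} (hC : 0 ≤ C) (L : Vec d → X → ℝ) {D D' : Dataset M N X}
    (st : State d k) {i : Fin M} {n : Fin N} (h : D i n = none ∨ D' i n = none) :
    ‖clientSketch C L D st i (some n) - clientSketch C L D' st i (some n)‖ ≤ C := by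
  rcases h with h | h
  · have : clientSketch C L D st i (some n) = 0 := by simp [clientSketch, h]
    rw [this, zero_sub, norm_neg]
    exact norm_clientSketch_le hC _ _ _ _ _
  · have : clientSketch C L D' st i (some n) = 0 := by simp [clientSketch, h]
    rw [this, sub_zero]
    exact norm_clientSketch_le hC _ _ _ _ _

theorem clientSketch_congr (C : ℝ) (L : Vec d → X → ℝ) {D D' : Dataset M N X} (st : State d k)
    {j : Fin M} {slot : Option (Fin N)} (h : ∀ n, slot = some n → D j n = D' j n) :
    clientSketch C L D st j slot = clientSketch C L D' st j slot := by
  unfold clientSketch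
  cases slot with
  | none => rfl
  | some n => simp [h n rfl]

/-- The law of the random choices in one round. -/
def roundLaw (d k M : ℕ) (a : ℝ) : Measure ((Fin M → Vec k) × (Fin k → Vec d)) :=
  (Measure.pi fun _ : Fin M => gaussianVec k a).prod (Measure.pi fun _ : Fin k => gaussianVec d 1)

instance (d k M : ℕ) (a : ℝ) : IsProbabilityMeasure (roundLaw d k M a) := by
  unfold roundLaw
  infer_instance

open Classical in
/-- Shifting the noise of all selected clients by `B⁻¹ • Δ` shifts the sum of the clipped sketches
by `Δ`, at the cost `‖Δ‖² / B`. -/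
theorem holderDominated_step {l : ℝ} (hl : 0 < l) {hp : Hyper} (hC : 0 < hp.C) (hB : 0 < B)
    {σ : ℝ} (ha : 0 < noiseVar N E B σ hp.C) (L : Vec d → X → ℝ) {D D' : Dataset M N X}
    {i : Fin M} {n : Fin N} (hnone : D i n = none ∨ D' i n = none)
    (hD : ∀ j m, (j, m) ≠ (i, n) → D j m = D' j m) (t : ℕ) (r : Round M N B) (st : State d k) :
    HolderDominated l (if r.draw i = some n then
        ENNReal.ofReal (Real.exp (l * hp.C ^ 2 / (2 * B * noiseVar N E B σ hp.C))) else 1)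
      (roundLaw d k M (noiseVar N E B σ hp.C))
      (fun w => step hp σ E L D t r w.1 w.2 st) (fun w => step hp σ E L D' t r w.1 w.2 st) := by
  have hm : Measurable fun w : (Fin M → Vec k) × (Fin k → Vec d) =>
      step hp σ E L D' t r w.1 w.2 st :=
    measurable_step hp σ E L D' t r measurable_const measurable_fst measurable_snd
  split_ifs with hr
  · set a := noiseVar N E B σ hp.C with ha'
    have hB' : (0 : ℝ) < B := by exact_mod_cast hB
    have hi : i ∈ r.clients := by
      by_contra hi
      rw [r.draw_eq_none i hi] at hr
      exact absurd hr (by simp)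
    set Δ : Vec k := clientSketch hp.C L D st i (r.draw i) - clientSketch hp.C L D' st i (r.draw i)
      with hΔ
    have hΔC : ‖Δ‖ ≤ hp.C := by
      rw [hΔ, hr]
      exact norm_clientSketch_sub_le hC.le L st hnone
    -- Equal shares minimize the total squared shift: `B (‖Δ‖ / B)² = ‖Δ‖² / B`.
    let s : Fin M → Vec k := fun j => if j ∈ r.clients then (B : ℝ)⁻¹ • Δ else 0
    have h1 := HolderDominated.pi hl (fun j => by fun_prop)
      fun j : Fin M => holderDominated_gaussianVec hl ha (s j)
    have h2 := (h1.prod_map hl (HolderDominated.refl hl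
      (Measure.pi fun _ : Fin k => gaussianVec d 1) measurable_id) (by fun_prop)
      measurable_id).map hm
    refine HolderDominated.mono ?_ ?_ (K := (∏ j, ENNReal.ofReal
      (Real.exp (l * ‖s j‖ ^ 2 / (2 * a)))) * 1)
    · rw [← ENNReal.ofReal_prod_of_nonneg (fun j _ => (Real.exp_pos _).le), ← Real.exp_sum,
        ← Finset.sum_div, ← Finset.mul_sum, mul_one]
      refine ENNReal.ofReal_le_ofReal (Real.exp_le_exp.2 ?_)
      have hs : ∑ j, ‖s j‖ ^ 2 = ‖Δ‖ ^ 2 / B := by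
        have : ∀ j, ‖s j‖ ^ 2 = if j ∈ r.clients then ((B : ℝ)⁻¹ * ‖Δ‖) ^ 2 else 0 := by
          intro j
          by_cases hj : j ∈ r.clients <;> simp [s, hj, norm_smul]
        simp_rw [this]
        rw [Finset.sum_ite_mem, Finset.univ_inter, Finset.sum_const, r.card_clients, nsmul_eq_mul]
        field_simp
      rw [hs, ← mul_div_assoc, div_div, ← mul_assoc, mul_comm (B : ℝ) 2]
      gcongr
    -- The run on `D` is the run on `D'` with shifted noises.
    · have hfun : (fun w : (Fin M → Vec k) × (Fin k → Vec d) => step hp σ E L D t r w.1 w.2 st) =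
          fun w => step hp σ E L D' t r (fun j => w.1 j + s j) w.2 st := ?_
      · rw [hfun]
        exact h2
      funext w
      simp only [step_eq_serverUpdate]
      congr 2
      have hsum : ∑ j ∈ r.clients, (clientSketch hp.C L D st j (r.draw j) -
          clientSketch hp.C L D' st j (r.draw j)) = Δ := by
        refine Finset.sum_eq_single_of_mem i hi fun j _ hj => ?_
        rw [sub_eq_zero]
        exact clientSketch_congr _ _ _ fun m _ => hD j m (by simp [hj])
      have hsum' : ∑ j ∈ r.clients, s j = Δ := by
        rw [Finset.sum_congr rfl fun j hj => show s j = (B : ℝ)⁻¹ • Δ by simp [s, hj],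
          Finset.sum_const, r.card_clients, ← Nat.cast_smul_eq_nsmul ℝ, smul_smul,
          mul_inv_cancel₀ hB'.ne', one_smul]
      rw [Finset.sum_sub_distrib, sub_eq_iff_eq_add] at hsum
      simp only [Finset.sum_add_distrib]
      rw [hsum, hsum']
      abel
  -- The differing record is not drawn, so the round is the same function on both datasets.
  · have : (fun w : (Fin M → Vec k) × (Fin k → Vec d) => step hp σ E L D t r w.1 w.2 st) =
        fun w => step hp σ E L D' t r w.1 w.2 st := by
      funext w
      simp only [step_eq_serverUpdate]
      congr 2
      refine Finset.sum_congr rfl fun j _ => ?_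
      congr 1
      refine clientSketch_congr _ _ _ fun m hm => hD j m fun h => hr ?_
      rw [Prod.mk.injEq] at h
      rw [← h.1, hm, h.2]
    rw [this]
    exact HolderDominated.refl hl _ hm

/-! ### Composition over the rounds -/

/-- The bound is uniform in the starting state, which is what adaptive composition needs. The
exponent counts the rounds that draw the differing position. -/
theorem holderDominated_stateFrom {l : ℝ} (hl : 0 < l) {hp : Hyper} (hC : 0 < hp.C) (hB : 0 < B)
    {σ : ℝ} (ha : 0 < noiseVar N E B σ hp.C) (L : Vec d → X → ℝ) {D D' : Dataset M N X}
    {i : Fin M} {n : Fin N} (hnone : D i n = none ∨ D' i n = none)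
    (hD : ∀ j m, (j, m) ≠ (i, n) → D j m = D' j m) (rs : List (Round M N B)) (t : ℕ)
    (st : State d k) :
    HolderDominated l
      (ENNReal.ofReal (Real.exp (l * hp.C ^ 2 / (2 * B * noiseVar N E B σ hp.C))) ^
        rs.countP fun r => decide (r.draw i = some n))
      (Measure.infinitePi fun _ : ℕ => roundLaw d k M (noiseVar N E B σ hp.C))
      (stateFrom hp σ E L D rs t st) (stateFrom hp σ E L D' rs t st) := by
  induction rs generalizing t st with
  | nil =>
    have h : ∀ D : Dataset M N X, stateFrom hp σ E L D ([] : List (Round M N B)) t st =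
        fun _ _ => st := fun D => funext fun ω => stateFrom_nil hp σ L D t st ω
    rw [h, h]
    simpa using HolderDominated.refl hl _ measurable_const
  | cons r rs ih =>
    -- The whole history is compared, so `st` is put back at index `0` in front of the later states.
    let u : Dataset M N X → State d k → (ℕ → (Fin M → Vec k) × (Fin k → Vec d)) → ℕ → State d k :=
      fun D st' ω n => Nat.casesOn n st (stateFrom hp σ E L D rs (t + 1) st' ω)
    have hcase : Measurable fun (x : ℕ → State d k) (n : ℕ) =>
        (Nat.casesOn n st x : State d k) := by
      refine measurable_pi_lambda _ fun n => ?_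
      cases n with
      | zero => exact measurable_const
      | succ n => exact measurable_pi_apply n
    have hu : ∀ D, Measurable fun p : State d k × (ℕ → (Fin M → Vec k) × (Fin k → Vec d)) =>
        u D p.1 p.2 :=
      fun D => hcase.comp (measurable_stateFrom hp σ E L D rs (t + 1))
    have hf : ∀ D, Measurable fun w : (Fin M → Vec k) × (Fin k → Vec d) =>
        step hp σ E L D (t + 1) r w.1 w.2 st :=
      fun D => measurable_step hp σ E L D (t + 1) r measurable_const measurable_fst measurable_snd
    have h1 := HolderDominated.prod hl (holderDominated_step hl hC hB ha L hnone hD (t + 1) r st)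
      (fun st' => (ih (t + 1) st').map hcase) (hf D) (hf D') (hu D) (hu D')
    have h2 := h1.comp_measurePreserving
      ((hu D).comp (((hf D).comp measurable_fst).prodMk measurable_snd))
      ((hu D').comp (((hf D').comp measurable_fst).prodMk measurable_snd))
      (measurePreserving_infinitePi_nat_cases (roundLaw d k M (noiseVar N E B σ hp.C)))
    have he : ∀ D : Dataset M N X, stateFrom hp σ E L D (r :: rs) t st = fun ω =>
        u D (step hp σ E L D (t + 1) r (ω 0).1 (ω 0).2 st) fun m => ω (m + 1) := by
      intro D
      funext ω n
      cases n with
      | zero => rfl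
      | succ n => exact stateFrom_cons hp σ L D r rs t st ω n
    rw [he D, he D']
    refine HolderDominated.mono (le_of_eq ?_) h2
    rw [List.countP_cons]
    by_cases hr : r.draw i = some n <;> simp [hr, pow_succ, mul_comm]

/-! ### Schedules -/

instance : Finite (Round M N B) := by
  refine Finite.of_injective (fun r : Round M N B => (r.clients, r.draw)) ?_
  rintro ⟨c, _, f, _⟩ ⟨c', _, f', _⟩ h
  simpa using h

/-- With the discrete σ-algebra on schedules, countability allows joint measurability to be checked
one schedule at a time. -/
instance : Countable (Schedule M N B E) := by
  refine Function.Injective.countable (f := fun s : Schedule M N B E => s.epoch) ?_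
  rintro ⟨e, _⟩ ⟨e', _⟩ h
  simpa using h

theorem Schedule.countP_rounds (s : Schedule M N B E) (i : Fin M) (n : Fin N) :
    s.rounds.countP (fun r => decide (r.draw i = some n)) = E := by
  have h : (List.countP fun r : Round M N B => decide (r.draw i = some n)) ∘ s.epoch =
      fun _ => 1 := funext fun e => s.full_pass e i n
  rw [Schedule.rounds, List.countP_flatten, List.map_ofFn, h]
  simp

/-! ### Privacy -/

theorem measurable_initState :
    Measurable fun p : Vec d × (Fin k → Vec d) => initState p.1 p.2 := by
  have := (measurable_qrQ (d := d) (p := k)).comp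
    (measurable_snd : Measurable fun p : Vec d × (Fin k → Vec d) => p.2)
  rw [State.measurable_iff]
  dsimp only [initState]
  fun_prop

theorem measurable_output (hp : Hyper) (σ : ℝ) (L : Vec d → X → ℝ) (D : Dataset M N X) :
    Measurable fun ω : Randomness d k M N B E => (ω.1, stateAt hp σ L D ω) := by
  refine measurable_from_prod_countable_right fun s => measurable_const.prodMk ?_
  have h : ∀ ω : Vec d × (Fin k → Vec d) × (ℕ → (Fin M → Vec k) × (Fin k → Vec d)),
      stateAt hp σ L D (s, ω) =
        stateFrom hp σ E L D s.rounds 0 (initState ω.1 ω.2.1) ω.2.2 :=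
    fun ω => funext fun n => stateAt_eq_stateFrom hp σ L D (s, ω) n
  simp only [h]
  exact (measurable_stateFrom hp σ E L D s.rounds 0).comp ((measurable_initState.comp
    (measurable_fst.prodMk measurable_snd.fst)).prodMk measurable_snd.snd)

instance (hp : Hyper) (σ : ℝ) (P : Measure (Schedule M N B E)) [IsProbabilityMeasure P]
    (μ₀ : Measure (Vec d)) [IsProbabilityMeasure μ₀] :
    IsProbabilityMeasure (randomnessLaw (k := k) hp σ P μ₀) := by
  unfold randomnessLaw
  infer_instance

theorem holderDominated_output {l : ℝ} (hl : 0 < l) {hp : Hyper} (hC : 0 < hp.C) (hB : 0 < B)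
    {σ : ℝ} (hσ : 0 < σ) (L : Vec d → X → ℝ) (P : Measure (Schedule M N B E))
    [IsProbabilityMeasure P] (μ₀ : Measure (Vec d)) [IsProbabilityMeasure μ₀]
    {D D' : Dataset M N X} {i : Fin M} {n : Fin N} (hnone : D i n = none ∨ D' i n = none)
    (hD : ∀ j m, (j, m) ≠ (i, n) → D j m = D' j m) :
    HolderDominated l (ENNReal.ofReal (Real.exp (l / (2 * σ ^ 2))))
      (randomnessLaw (k := k) hp σ P μ₀)
      (fun ω => (ω.1, stateAt hp σ L D ω)) (fun ω => (ω.1, stateAt hp σ L D' ω)) := by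
  have key : ∀ (rs : List (Round M N B)) (st : State d k),
      rs.countP (fun r => decide (r.draw i = some n)) = E → (E = 0 → rs = []) →
      HolderDominated l (ENNReal.ofReal (Real.exp (l / (2 * σ ^ 2))))
        (Measure.infinitePi fun _ : ℕ => roundLaw d k M (noiseVar N E B σ hp.C))
        (stateFrom hp σ E L D rs 0 st) (stateFrom hp σ E L D' rs 0 st) := by
    intro rs st hcount hnil
    rcases Nat.eq_zero_or_pos E with hE | hE
    -- Without epochs the noise variance is `0` and the Gaussian bound is unavailable, but there are
    -- no rounds either.
    · have h : ∀ D : Dataset M N X, stateFrom hp σ E L D rs 0 st = fun _ _ => st := fun D =>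
        funext fun ω => by rw [hnil hE]; exact stateFrom_nil hp σ L D 0 st ω
      rw [h, h]
      refine HolderDominated.mono ?_ (HolderDominated.refl hl _ measurable_const)
      rw [ENNReal.one_le_ofReal]
      exact Real.one_le_exp (by positivity)
    · have hN : 0 < N := n.pos
      have hN' : (1 : ℝ) ≤ N := by exact_mod_cast hN
      have hE' : (0 : ℝ) < E := by exact_mod_cast hE
      have hB' : (0 : ℝ) < B := by exact_mod_cast hB
      have ha : 0 < noiseVar N E B σ hp.C := by unfold noiseVar; positivity
      refine HolderDominated.mono ?_
        (holderDominated_stateFrom hl hC hB ha L hnone hD rs 0 st)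
      rw [hcount, ← ENNReal.ofReal_pow (Real.exp_pos _).le, ← Real.exp_nat_mul]
      refine ENNReal.ofReal_le_ofReal (Real.exp_le_exp.2 ?_)
      -- The noise variance carries a factor `N` that is not needed here and is discarded through `N
      -- ≥ 1`.
      have : (E : ℝ) * (l * hp.C ^ 2 / (2 * B * noiseVar N E B σ hp.C)) =
          l / (2 * (N * σ ^ 2)) := by
        unfold noiseVar
        field_simp
      rw [this]
      gcongr
      exact le_mul_of_one_le_left (by positivity) hN'
  have hmeas : ∀ (D : Dataset M N X) (s : Schedule M N B E), Measurable
      fun ω : Vec d × (Fin k → Vec d) × (ℕ → (Fin M → Vec k) × (Fin k → Vec d)) =>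
        (s, stateAt hp σ L D (s, ω)) :=
    fun D s => (measurable_output hp σ L D).comp measurable_prodMk_left
  refine HolderDominated.prod_fiber hl
    (u := fun s ω => (s, stateAt hp σ L D (s, ω))) (w := fun s ω => (s, stateAt hp σ L D' (s, ω)))
    (fun s => ?_) (measurable_output hp σ L D) (measurable_output hp σ L D')
  refine HolderDominated.prod_fiber hl
    (u := fun θ₀ ω => (s, stateAt hp σ L D (s, θ₀, ω)))
    (w := fun θ₀ ω => (s, stateAt hp σ L D' (s, θ₀, ω)))
    (fun θ₀ => ?_) (hmeas D s) (hmeas D' s)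
  refine HolderDominated.prod_fiber hl
    (u := fun Ω₀ ω => (s, stateAt hp σ L D (s, θ₀, Ω₀, ω)))
    (w := fun Ω₀ ω => (s, stateAt hp σ L D' (s, θ₀, Ω₀, ω)))
    (fun Ω₀ => ?_) ((hmeas D s).comp measurable_prodMk_left)
    ((hmeas D' s).comp measurable_prodMk_left)
  have h := (key s.rounds (initState θ₀ Ω₀) (s.countP_rounds i n) fun hE => by
    subst hE; simp [Schedule.rounds]).map (measurable_prodMk_left (x := s))
  have he : ∀ (D : Dataset M N X) (ω : ℕ → (Fin M → Vec k) × (Fin k → Vec d)),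
      stateAt hp σ L D (s, θ₀, Ω₀, ω) =
        stateFrom hp σ E L D s.rounds 0 (initState θ₀ Ω₀) ω :=
    fun D ω => funext fun n => stateAt_eq_stateFrom hp σ L D (s, θ₀, Ω₀, ω) n
  simp only [he]
  exact h

/-- The exponent equals `ε / 4 - 3 ε² σ² / 8`. The first lower bound on `σ` gives `ε ≤ ε² σ²`, so
the exponent is at most `-ε² σ² / 8`; by the second this is at most `log δ`. -/
theorem exp_conversion_le {ε δ σ : ℝ} (hε : 0 < ε) (hδ : 0 < δ)
    (h1 : 1 / Real.sqrt ε ≤ σ)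
    (h2 : 2 * Real.sqrt 2 / ε * Real.sqrt (Real.log (1 / δ)) ≤ σ) :
    Real.exp ((1 + ε * σ ^ 2 / 2) * (ε * σ ^ 2 / 2 / (2 * σ ^ 2)) - ε * σ ^ 2 / 2 * ε) ≤ δ := by
  have hσ : 0 < σ := lt_of_lt_of_le (by positivity) h1
  have e1 : 1 ≤ ε * σ ^ 2 := by
    have := pow_le_pow_left₀ (by positivity) h1 2
    rw [div_pow, one_pow, Real.sq_sqrt hε.le, div_le_iff₀ hε] at this
    linarith
  have e2 : Real.log (1 / δ) ≤ ε ^ 2 * σ ^ 2 / 8 := by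
    rcases le_or_gt (Real.log (1 / δ)) 0 with h | h
    · exact h.trans (by positivity)
    · have := pow_le_pow_left₀ (by positivity) h2 2
      rw [mul_pow, div_pow, mul_pow, Real.sq_sqrt (by norm_num), Real.sq_sqrt h.le,
        div_mul_eq_mul_div, div_le_iff₀ (by positivity)] at this
      linarith
  rw [← Real.le_log_iff_exp_le hδ]
  have e3 : ε * σ ^ 2 / 2 / (2 * σ ^ 2) = ε / 4 := by field_simp; norm_num
  rw [e3]
  rw [one_div, Real.log_inv] at e2
  nlinarith [mul_le_mul_of_nonneg_left e1 hε.le]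

end DOME

end

theorem mainTheorem1 {d k M N B E : ℕ} {X : Type*} (hkd : k ≤ d) (hB : 0 < B)
    (L : DOME.Vec d → X → ℝ) (hp : DOME.Hyper) (hC : 0 < hp.C)
    (P : MeasureTheory.Measure (DOME.Schedule M N B E)) [MeasureTheory.IsProbabilityMeasure P]
    (μ₀ : MeasureTheory.Measure (DOME.Vec d)) [MeasureTheory.IsProbabilityMeasure μ₀]
    (ε δ σ : ℝ) (hε : 0 < ε) (hδ : 0 < δ) (hδ1 : δ < 1)
    (hσ : σ = max (1 / Real.sqrt ε)
      (2 * Real.sqrt 2 / ε * Real.sqrt (Real.log (1 / δ)))) :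
    DOME.IsDifferentiallyPrivate DOME.Adjacent ε δ
      (DOME.dome (k := k) hp σ L P μ₀ : DOME.Dataset M N X → _) := by
  have h1 : 1 / Real.sqrt ε ≤ σ := hσ ▸ le_max_left _ _
  have h2 : 2 * Real.sqrt 2 / ε * Real.sqrt (Real.log (1 / δ)) ≤ σ := hσ ▸ le_max_right _ _
  have hσ0 : 0 < σ := lt_of_lt_of_le (by positivity) h1
  refine ⟨fun D => MeasureTheory.Measure.isProbabilityMeasure_map
    (DOME.measurable_output hp σ L D).aemeasurable, ?_⟩
  rintro D D' (rfl | ⟨i, n, hnone, hD⟩) A hA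
  · refine le_add_right (le_mul_of_one_le_left zero_le ?_)
    rw [ENNReal.one_le_ofReal]
    exact Real.one_le_exp hε.le
  · unfold DOME.dome
    rw [MeasureTheory.Measure.map_apply (DOME.measurable_output hp σ L D) hA,
      MeasureTheory.Measure.map_apply (DOME.measurable_output hp σ L D') hA]
    -- With `l = ε σ² / 2` the total cost `l / (2 σ²)` becomes `ε / 4`.
    have hl : 0 < ε * σ ^ 2 / 2 := by positivity
    exact (DOME.holderDominated_output hl hC hB hσ0 L P μ₀ hnone hD).measure_preimage_le hl
      (DOME.measurable_output hp σ L D) (DOME.measurable_output hp σ L D')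
      (DOME.exp_conversion_le hε hδ h1 h2) hA
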